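/- \textbf{Setting.} Fix an infinite set $\mathfrak D$ of data values. For a non-empty finite alphabet $\Sigma$ and $m\in\mathbb N$, a data word is a finite sequence $w=w_1\dots w_n$ over $\Sigma\times\mathfrak D^m$; write $\ell(i)\in\Sigma$ for the label and $d^k(i)\in\mathfrak D$ for the $k$-th data value of position $i\in[n]=\{1,\dots,n\}$. A \emph{signature} $\mathscr S$ (for $\Sigma$, $\mathfrak D$, $m$) is a finite set of relation symbols $\lhd$ together with an interpretation that associates with every $\lhd\in\mathscr S$ and every data word $w$ of length $n$ a relation $\lhd^w\subseteq[n]\times[n]$ such that (1) $i\lhd^w j$ implies $i<j$; (2) for each $i$ there is at most one $k$ with $i\lhd^w k$; (3) for each $i$ there is at most one $k$ with $k\lhd^w i$; (4) if $i\lhd^w j$, $i'\lhd^w j'$, $w_i=w_{i'}$ and $w_j=w_{j'}$, then $i<i'$ iff $j<j'$. If $j\lhd^w i$ we write $\mathrm{prev}_\lhd(i)=j$ and $\mathrm{next}_\lhd(j)=i$ (partial functions). Let $\mathrm{dist}^w$ be the distance in the undirected graph on $[n]$ whose edges are given by all relations $\lhd^w$, and let $\mathfrak D_B^k(i)=\{d^k(j)\mid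 \mathrm{dist}^w(i,j)\le B\}$. A \emph{class register automaton} over $\mathscr S$ is a tuple $\mathcal A=(Q,R,\Delta,(F_\lhd)_{\lhd\in\mathscr S},\Phi)$ with a finite set $Q$ of states, a finite set $R$ of registers, sets $F_\lhd\subseteq Q$, a boolean formula $\Phi$ over atoms `$q\le N$' ($q\in Q$, $N\in\mathbb N$), and a finite set $\Delta$ of transitions $(p,g)\xrightarrow{a}(q,f)$, where $p:\mathscr S\rightharpoonup Q$ is a partial mapping, $g$ is a boolean formula over atoms `$\theta_1=\theta_2$' with $\theta_1,\theta_2\in[m]\cup(\mathrm{dom}(p)\times R)$, $a\in\Sigma$, $q\in Q$, and $f:R\rightharpoonup(\mathrm{dom}(p)\times R)\cup([m]\times\mathbb N)$ is a partial mapping. A run on $w=w_1\dots w_n$ is a sequence $(q_1,\rho_1)\dots(q_n,\rho_n)$ with $q_i\in Q$ and $\rho_i:R\rightharpoonup\mathfrak D$ such that for each $i$ there is a transition $(p,g)\xrightarrow{\ell(i)}(q_i,f)$ in $\Delta$ with: $\mathrm{dom}(p)=\{\lhd\mid \mathrm{prev}_\lhd(i)\text{ is defined}\}$; $p(\lhd)=q_{\mathrm{prev}_\lhd(i)}$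 for $\lhd\in\mathrm{dom}(p)$; $g$ is true when $\theta_1=\theta_2$ is read as `both values are defined and equal', the value of $k\in[m]$ being $d^k(i)$ and that of $(\lhd,r)$ being $\rho_{\mathrm{prev}_\lhd(i)}(r)$; and for each $r\in R$: $\rho_i(r)=\rho_{\mathrm{prev}_\lhd(i)}(r')$ if $f(r)=(\lhd,r')$ (in particular, one side is defined iff the other is), $\rho_i(r)\in\mathfrak D_B^k(i)$ if $f(r)=(k,B)$, and $\rho_i(r)$ is undefined if $f(r)$ is. The run is accepting if $q_i\in F_\lhd$ whenever $\mathrm{next}_\lhd(i)$ is undefined, and $\Phi$ holds when $q\le N$ is read as $|\{i\mid q_i=q\}|\le N$. $L(\mathcal A)$ is the set of data words that have an accepting run. $\mathbb{CRA}(\mathscr S)$ is the class of all languages $L(\mathcal A)$; $\mathbb{CRA}^-(\mathscr S)$ is the class of those with $\mathcal A$ \emph{non-guessing} (if $f(r)=(k,B)$ in a transition, then $B=0$); $\mathbb{CMA}(\mathscr S)$ is the class of those with $\mathcal A$ a \emph{class memory automaton} (in every transition $f$ is undefined everywhere). For a non-empty finite alphabet $\Gamma$, let $\mathrm{proj}_\Sigma$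 remove the $\Gamma$-component of the labels of a data word over $(\Sigma\times\Gamma)\times\mathfrak D^m$, and let $\mathscr S_\Gamma$ be the signature for such words with one symbol $\lhd_\Gamma$ for each $\lhd\in\mathscr S$, where $i\lhd_\Gamma^w j$ iff $i\lhd^{\mathrm{proj}_\Sigma(w)}j$. \textbf{Lemma.} Let $\mathcal C$ be any of $\mathbb{CRA}$, $\mathbb{CRA}^-$, $\mathbb{CMA}$. (a) For every $\Sigma$, $m$ and every signature $\mathscr S$, the class $\mathcal C(\mathscr S)$ is closed under union and intersection, and under projection: for every non-empty finite alphabet $\Gamma$ and every $L\in\mathcal C(\mathscr S_\Gamma)$, $\mathrm{proj}_\Sigma(L)\in\mathcal C(\mathscr S)$. (b) In general these classes are not closed under complementation: there are $\Sigma$, $m$ and a signature $\mathscr S$ such that, for each of the three choices of $\mathcal C$, there is $L\in\mathcal C(\mathscr S)$ with $(\Sigma\times\mathfrak D^m)^*\setminus L\notin\mathcal C(\mathscr S)$. -/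

import Mathlib

namespace ClassRegister

universe u v w x

/-! ### Boolean formulas -/

/-- Boolean formulas over a set `α` of atoms. -/
inductive BoolFormula (α : Type u) : Type u
  | tt : BoolFormula α
  | ff : BoolFormula α
  | atom : α → BoolFormula α
  | neg : BoolFormula α → BoolFormula α
  | or : BoolFormula α → BoolFormula α → BoolFormula α
  | and : BoolFormula α → BoolFormula α → BoolFormula α

/-- Truth of a boolean formula under the assignment `v` of truth values to the atoms. -/
def BoolFormula.Eval {α : Type u} (v : α → Prop) : BoolFormula α → Prop
  | .tt => True
  | .ff => False
  | .atom a => v a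
  | .neg φ => ¬ φ.Eval v
  | .or φ ψ => φ.Eval v ∨ ψ.Eval v
  | .and φ ψ => φ.Eval v ∧ ψ.Eval v

/-! ### Data words and signatures -/

/-- A data word: a finite sequence (of length `len`, positions `Fin len`) over `A × D ^ m`. -/
structure DataWord (A : Type v) (D : Type u) (m : ℕ) where
  /-- the length of the word -/
  len : ℕ
  /-- the letter at a position: a label together with `m` data values -/
  get : Fin len → A × (Fin m → D)

namespace DataWord

variable {A : Type v} {D : Type u} {m : ℕ}

/-- The label of position `i`. -/
def label (w : DataWord A D m) (i : Fin w.len) : A := (w.get i).1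

/-- The `k`-th data value of position `i`. -/
def data (w : DataWord A D m) (i : Fin w.len) (k : Fin m) : D := (w.get i).2 k

/-- The projection that removes the `Γ`-component of the labels and keeps the data values. -/
def proj {Γ : Type x} (w : DataWord (A × Γ) D m) : DataWord A D m where
  len := w.len
  get i := ((w.get i).1.1, (w.get i).2)

end DataWord

/-- A signature with relation symbols `σ` for data words over `A × D ^ m`: an interpretation of
every symbol, on every data word, as a binary relation on positions that (1) complies with `<`,
(2) has out-degree at most one, (3) has in-degree at most one and (4) is monotone. -/
structure Signature (σ : Type w) (A : Type v) (D : Type u) (m : ℕ) where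
  /-- `Rel s w i j`: position `i` of `w` is related to position `j` by the symbol `s` -/
  Rel : σ → (w : DataWord A D m) → Fin w.len → Fin w.len → Prop
  lt_of_rel : ∀ s w i j, Rel s w i j → i < j
  out_unique : ∀ s w i j k, Rel s w i j → Rel s w i k → j = k
  in_unique : ∀ s w i j k, Rel s w j i → Rel s w k i → j = k
  monotone : ∀ s w i j i' j', Rel s w i j → Rel s w i' j' →
    w.get i = w.get i' → w.get j = w.get j' → (i < i' ↔ j < j')

namespace Signature

variable {σ : Type w} {A : Type v} {D : Type u} {m : ℕ}

/-- The undirected graph on the positions of `w` whose edges come from all relations. -/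
def graph (S : Signature σ A D m) (w : DataWord A D m) : SimpleGraph (Fin w.len) :=
  SimpleGraph.fromRel fun i j => ∃ s, S.Rel s w i j

/-- `S.ball w B i j`: the distance between `i` and `j` in the graph of `w` is at most `B`. -/
def ball (S : Signature σ A D m) (w : DataWord A D m) (B : ℕ) (i j : Fin w.len) : Prop :=
  (S.graph w).edist i j ≤ (B : ℕ∞)

/-- The signature for data words over `(A × Γ) × D ^ m` that has one copy of each symbol of `S`,
interpreted on `w` as the original symbol is interpreted on the projection of `w`. -/
def extend (S : Signature σ A D m) (Γ : Type x) : Signature σ (A × Γ) D m where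
  Rel s w i j := S.Rel s w.proj i j
  lt_of_rel s w i j h := S.lt_of_rel s w.proj i j h
  out_unique s w i j k h h' := S.out_unique s w.proj i j k h h'
  in_unique s w i j k h h' := S.in_unique s w.proj i j k h h'
  monotone s w i j i' j' h h' e e' :=
    S.monotone s w.proj i j i' j' h h' (by simp only [DataWord.proj, e])
      (by simp only [DataWord.proj, e'])

end Signature

/-! ### Class register automata -/

/-- A transition `(p, g) --a--> (q, f)`. -/
structure Transition (σ : Type w) (A : Type v) (m : ℕ) (Q R : Type) where
  /-- the source states, a partial mapping from relation symbols to states -/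
  p : σ → Option Q
  /-- the guard, whose atom `(θ₁, θ₂)` stands for the comparison `θ₁ = θ₂`; a term `θ` is the index
  of a current data value or a pair of a symbol in the domain of `p` and a register -/
  g : BoolFormula ((Fin m ⊕ {s : σ // (p s).isSome} × R) × (Fin m ⊕ {s : σ // (p s).isSome} × R))
  /-- the label that is read -/
  a : A
  /-- the target state -/
  q : Q
  /-- the register update, a partial mapping: a register obtains an old register entry or some
  `k`-th data value from within distance `B` -/
  f : R → Option (({s : σ // (p s).isSome} × R) ⊕ (Fin m × ℕ))

/-- A class register automaton with relation symbols `σ`, labels `A` and `m` data values. -/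
structure Automaton (σ : Type w) (A : Type v) (m : ℕ) where
  /-- the states -/
  Q : Type
  /-- the registers -/
  R : Type
  finite_Q : Finite Q
  finite_R : Finite R
  /-- the transitions -/
  Δ : Set (Transition σ A m Q R)
  finite_Δ : Δ.Finite
  /-- the local final states -/
  F : σ → Set Q
  /-- the global acceptance condition, whose atom `(q, N)` stands for `q ≤ N` -/
  Φ : BoolFormula (Q × ℕ)

section Semantics

variable {σ : Type w} {A : Type v} {D : Type u} {m : ℕ} {Q R : Type}

/-- Given register contents `ρ`, the term `θ` is defined at position `i` and has value `d`. For a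
pair `(s, r)`, this is the entry of `r` at the unique `s`-predecessor of `i`. -/
def HasValue (S : Signature σ A D m) (w : DataWord A D m) (ρ : Fin w.len → R → Option D)
    {P : σ → Prop} (i : Fin w.len) (θ : Fin m ⊕ {s : σ // P s} × R) (d : D) : Prop :=
  match θ with
  | .inl k => w.data i k = d
  | .inr (s, r) => ∃ j, S.Rel s.1 w j i ∧ ρ j r = some d

/-- The transition `t` justifies the configuration at position `i` of the sequence of
configurations `(q, ρ)`. -/
structure Justifies (S : Signature σ A D m) (w : DataWord A D m) (q : Fin w.len → Q)
    (ρ : Fin w.len → R → Option D) (i : Fin w.len) (t : Transition σ A m Q R) : Prop where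
  label_eq : t.a = w.label i
  target_eq : t.q = q i
  dom_iff : ∀ s, (t.p s).isSome ↔ ∃ j, S.Rel s w j i
  source_eq : ∀ s j, S.Rel s w j i → t.p s = some (q j)
  guard : t.g.Eval fun θ => ∃ d, HasValue S w ρ i θ.1 d ∧ HasValue S w ρ i θ.2 d
  update_copy : ∀ r s r', t.f r = some (.inl (s, r')) → ∀ j, S.Rel s.1 w j i → ρ i r = ρ j r'
  update_guess : ∀ r k B, t.f r = some (.inr (k, B)) →
    ∃ j, S.ball w B i j ∧ ρ i r = some (w.data j k)
  update_undef : ∀ r, t.f r = none → ρ i r = none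

end Semantics

namespace Automaton

variable {σ : Type w} {A : Type v} {D : Type u} {m : ℕ}

/-- The sequence of configurations `(q, ρ)` is a run of `𝒜` on `w`. -/
def IsRun (𝒜 : Automaton σ A m) (S : Signature σ A D m) (w : DataWord A D m)
    (q : Fin w.len → 𝒜.Q) (ρ : Fin w.len → 𝒜.R → Option D) : Prop :=
  ∀ i, ∃ t ∈ 𝒜.Δ, Justifies S w q ρ i t

/-- The local and the global acceptance condition for the states `q` of a run on `w`. -/
def Accepting (𝒜 : Automaton σ A m) (S : Signature σ A D m) (w : DataWord A D m)
    (q : Fin w.len → 𝒜.Q) : Prop :=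
  (∀ i s, (¬ ∃ j, S.Rel s w i j) → q i ∈ 𝒜.F s) ∧
    𝒜.Φ.Eval fun c => {i | q i = c.1}.ncard ≤ c.2

/-- The language of `𝒜` over the signature `S`. -/
def language (𝒜 : Automaton σ A m) (S : Signature σ A D m) : Set (DataWord A D m) :=
  {w | ∃ q ρ, 𝒜.IsRun S w q ρ ∧ 𝒜.Accepting S w q}

/-- Non-guessing: every data value that is written into a register is an old register entry or a
value of the current position. -/
def IsNonGuessing (𝒜 : Automaton σ A m) : Prop :=
  ∀ t ∈ 𝒜.Δ, ∀ r k B, t.f r = some (.inr (k, B)) → B = 0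

/-- Class memory automaton: all update functions are undefined everywhere. -/
def IsClassMemory (𝒜 : Automaton σ A m) : Prop :=
  ∀ t ∈ 𝒜.Δ, ∀ r, t.f r = none

end Automaton

/-- The three automata models: class register automata, non-guessing class register automata and
class memory automata. -/
inductive Model
  | cra
  | craMinus
  | cma

/-- The automata that belong to a model. -/
def Model.Admits {σ : Type w} {A : Type v} {m : ℕ} : Model → Automaton σ A m → Prop
  | .cra, _ => True
  | .craMinus, 𝒜 => 𝒜.IsNonGuessing
  | .cma, 𝒜 => 𝒜.IsClassMemory

/-- The class of languages recognized by the automata of a model over the signature `S`. -/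
def Model.Lang {σ : Type w} {A : Type v} {D : Type u} {m : ℕ} (C : Model)
    (S : Signature σ A D m) : Set (Set (DataWord A D m)) :=
  {L | ∃ 𝒜 : Automaton σ A m, C.Admits 𝒜 ∧ 𝒜.language S = L}

end ClassRegister

/-!
Closure under union, intersection and projection comes from the usual automata constructions,
which change neither the distances in register updates nor the places where updates are undefined,
so that they stay inside each of the three models. The graph of a word need not be connected, hence
a disjoint union of two automata could process different components by different automata; the
global acceptance condition forbids this, since it can state that no state of one of them occurs.
For the product, a bound on the number of positions whose first component is a given state is a
bound on a sum of state counts, which is a boolean combination of bounds on the single counts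
(`BoolFormula.exists_eval_count_comp`). A projection guesses the erased letters through the
choice of the transitions.

Complementation fails for all models at once: over a suitable signature, one language is recognized
by a class memory automaton while its complement is recognized by no class register automaton.
The words of interest are pairs of square pictures of the same size `n × n`, with the grid relations
inside each picture, and with the two pictures connected only through corresponding cells of their
main diagonals.

* That the pictures differ can be certified locally (`pictureWord_mem_of_ne`): mark a row and a
  column. The marks pass through the diagonal, so the same row and column are marked in both
  pictures, and the global condition says that exactly one of the marked crossings carries the
  label `false`.
* Equality cannot be recognized (`Automaton.exists_ne_pictureWord_mem`): with a single data value,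
  there are only finitely many configurations of registers and states, so the `n` diagonal cells
  have `k ^ n` joint configurations for a constant `k`, and the global condition sees only
  boundedly many values of the state counts. As there are `2 ^ (n * n)` pictures, accepting runs on
  two pairs `(P, P)` and `(P', P')` can be mixed into an accepting run on `(P, P')`.
-/

namespace ClassRegister

universe u v w x

/-! ### Boolean formulas and counting -/

namespace BoolFormula

variable {α : Type u} {β : Type v}

/-- Replace every atom by a formula. -/
def bind (f : α → BoolFormula β) : BoolFormula α → BoolFormula β
  | .tt => .tt
  | .ff => .ff
  | .atom a => f a
  | .neg φ => .neg (φ.bind f)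
  | .or φ ψ => .or (φ.bind f) (ψ.bind f)
  | .and φ ψ => .and (φ.bind f) (ψ.bind f)

theorem eval_bind_iff {f : α → BoolFormula β} {v : β → Prop} {v' : α → Prop}
    (h : ∀ a, (f a).Eval v ↔ v' a) (φ : BoolFormula α) : (φ.bind f).Eval v ↔ φ.Eval v' := by
  induction φ with
  | tt => exact Iff.rfl
  | ff => exact Iff.rfl
  | atom a => exact h a
  | neg φ ih => exact not_congr ih
  | or φ ψ ih₁ ih₂ => exact or_congr ih₁ ih₂
  | and φ ψ ih₁ ih₂ => exact and_congr ih₁ ih₂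

/-- Rename the atoms. -/
def map (f : α → β) (φ : BoolFormula α) : BoolFormula β := φ.bind fun a => .atom (f a)

theorem eval_map_iff {f : α → β} {v : β → Prop} {v' : α → Prop} (h : ∀ a, v (f a) ↔ v' a)
    (φ : BoolFormula α) : (φ.map f).Eval v ↔ φ.Eval v' :=
  eval_bind_iff h φ

theorem eval_congr {v v' : α → Prop} (h : ∀ a, v a ↔ v' a) (φ : BoolFormula α) :
    φ.Eval v ↔ φ.Eval v' := by
  rw [show v = v' from funext fun a => propext (h a)]

/-- A bound on a sum of counters is a boolean combination of bounds on the single counters: split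
the bound among the summands in all possible ways. -/
theorem exists_eval_iff_sum_le {Q : Type u} (T : Finset Q) (N : ℕ) :
    ∃ φ : BoolFormula (Q × ℕ), ∀ c : Q → ℕ,
      φ.Eval (fun x => c x.1 ≤ x.2) ↔ ∑ q ∈ T, c q ≤ N := by
  classical
  induction T using Finset.induction_on generalizing N with
  | empty => exact ⟨.tt, fun c => by simp [Eval]⟩
  | insert q T hq ih =>
    choose φ hφ using ih
    have key : ∀ K, ∃ ψ : BoolFormula (Q × ℕ), ∀ c : Q → ℕ,
        ψ.Eval (fun x => c x.1 ≤ x.2) ↔ ∃ k < K, c q ≤ k ∧ ∑ q ∈ T, c q ≤ N - k := by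
      intro K
      induction K with
      | zero => exact ⟨.ff, fun c => by simp [Eval]⟩
      | succ K ihK =>
        obtain ⟨ψ, hψ⟩ := ihK
        refine ⟨.or ψ (.and (.atom (q, K)) (φ (N - K))), fun c => ?_⟩
        simp only [Eval, hψ, hφ]
        constructor
        · rintro (⟨k, hk, h⟩ | h)
          · exact ⟨k, by omega, h⟩
          · exact ⟨K, by omega, h⟩
        · rintro ⟨k, hk, h⟩
          rcases Nat.lt_succ_iff_lt_or_eq.1 hk with hk | rfl
          · exact Or.inl ⟨k, hk, h⟩
          · exact Or.inr h
    obtain ⟨ψ, hψ⟩ := key (N + 1)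
    refine ⟨ψ, fun c => ?_⟩
    rw [hψ, Finset.sum_insert hq]
    constructor
    · rintro ⟨k, hk, h₁, h₂⟩
      omega
    · intro h
      exact ⟨c q, by omega, le_rfl, by omega⟩

/-- A global condition on the images of the states under `h` can be expressed as a global condition
on the states themselves. -/
theorem exists_eval_count_comp {Q Q' : Type} [Finite Q'] (h : Q' → Q) (Φ : BoolFormula (Q × ℕ)) :
    ∃ Φ' : BoolFormula (Q' × ℕ), ∀ (n : ℕ) (q : Fin n → Q'),
      Φ'.Eval (fun c => {i | q i = c.1}.ncard ≤ c.2) ↔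
        Φ.Eval (fun c => {i | h (q i) = c.1}.ncard ≤ c.2) := by
  classical
  have := Fintype.ofFinite Q'
  choose φ hφ using fun x : Q × ℕ =>
    exists_eval_iff_sum_le (Finset.univ.filter fun y => h y = x.1) x.2
  refine ⟨Φ.bind φ, fun n q => eval_bind_iff (fun a => ?_) Φ⟩
  rw [hφ a (fun y => {i | q i = y}.ncard)]
  suffices hs : ∑ y ∈ Finset.univ.filter (fun y => h y = a.1), {i | q i = y}.ncard =
      {i | h (q i) = a.1}.ncard by rw [hs]
  simp only [Set.ncard_eq_toFinset_card', Set.toFinset_ofPred]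
  rw [Finset.card_eq_sum_card_fiberwise (f := q)
    (t := Finset.univ.filter fun y => h y = a.1) (by intro i; simp)]
  refine Finset.sum_congr rfl fun y hy => ?_
  congr 1
  ext i
  simp only [Finset.mem_filter, Finset.mem_univ, true_and] at hy ⊢
  constructor
  · rintro rfl
    exact ⟨hy, rfl⟩
  · exact fun h => h.2

/-- A global condition does not change under an injective renaming of the states. -/
theorem eval_count_map_iff {Q Q' : Type} {e : Q → Q'} (he : Function.Injective e)
    (Φ : BoolFormula (Q × ℕ)) {n : ℕ} (q : Fin n → Q) :
    (Φ.map (Prod.map e id)).Eval (fun c => {i | e (q i) = c.1}.ncard ≤ c.2) ↔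
      Φ.Eval (fun c => {i | q i = c.1}.ncard ≤ c.2) :=
  eval_map_iff (fun a => by simp [he.eq_iff]) Φ

/-- A global condition only depends on the numbers of occurrences up to some threshold. -/
theorem exists_threshold {Q : Type u} (Φ : BoolFormula (Q × ℕ)) :
    ∃ T : ℕ, ∀ c c' : Q → ℕ, (∀ q, min (c q) T = min (c' q) T) →
      (Φ.Eval (fun x => c x.1 ≤ x.2) ↔ Φ.Eval (fun x => c' x.1 ≤ x.2)) := by
  induction Φ with
  | tt => exact ⟨0, fun c c' _ => Iff.rfl⟩
  | ff => exact ⟨0, fun c c' _ => Iff.rfl⟩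
  | atom x =>
    refine ⟨x.2 + 1, fun c c' h => ?_⟩
    have := h x.1
    simp only [Eval]
    omega
  | neg φ ih =>
    obtain ⟨T, h⟩ := ih
    exact ⟨T, fun c c' hc => not_congr (h c c' hc)⟩
  | or φ ψ ih₁ ih₂ | and φ ψ ih₁ ih₂ =>
    obtain ⟨T₁, h₁⟩ := ih₁
    obtain ⟨T₂, h₂⟩ := ih₂
    refine ⟨max T₁ T₂, fun c c' hc => ?_⟩
    have e₁ := h₁ c c' fun q => by have := hc q; omega
    have e₂ := h₂ c c' fun q => by have := hc q; omega
    simp only [Eval, e₁, e₂]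

end BoolFormula

/-! ### Lifting guards and updates to more symbols and registers -/

section Lift

variable {σ : Type w} {A : Type v} {D : Type u} {m : ℕ} {Q Q' Q₁ Q₂ R R' R₁ R₂ : Type}
  {P P' : σ → Prop}

/-- Rename the registers of a guard term along `ι`, with a larger set of admissible symbols. -/
def liftTerm (h : ∀ s, P s → P' s) (ι : R → R') :
    Fin m ⊕ {s : σ // P s} × R → Fin m ⊕ {s : σ // P' s} × R' :=
  Sum.map id (Prod.map (Subtype.map id h) ι)

/-- Rename the registers in the source of a register update. -/
def liftSource (h : ∀ s, P s → P' s) (ι : R → R') :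
    ({s : σ // P s} × R) ⊕ (Fin m × ℕ) → ({s : σ // P' s} × R') ⊕ (Fin m × ℕ) :=
  Sum.map (Prod.map (Subtype.map id h) ι) id

/-- Rename the registers of a guard. -/
def liftGuard (h : ∀ s, P s → P' s) (ι : R → R')
    (g : BoolFormula ((Fin m ⊕ {s : σ // P s} × R) × (Fin m ⊕ {s : σ // P s} × R))) :
    BoolFormula ((Fin m ⊕ {s : σ // P' s} × R') × (Fin m ⊕ {s : σ // P' s} × R')) :=
  g.map (Prod.map (liftTerm h ι) (liftTerm h ι))

variable {S : Signature σ A D m} {w : DataWord A D m}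

theorem hasValue_liftTerm {h : ∀ s, P s → P' s} {ι : R → R'} {ρ : Fin w.len → R' → Option D}
    {i : Fin w.len} {θ : Fin m ⊕ {s : σ // P s} × R} {d : D} :
    HasValue S w ρ i (liftTerm h ι θ) d ↔ HasValue S w (fun j r => ρ j (ι r)) i θ d := by
  rcases θ with k | ⟨s, r⟩ <;> exact Iff.rfl

theorem eval_liftGuard {h : ∀ s, P s → P' s} {ι : R → R'} {ρ : Fin w.len → R' → Option D}
    {i : Fin w.len}
    {g : BoolFormula ((Fin m ⊕ {s : σ // P s} × R) × (Fin m ⊕ {s : σ // P s} × R))} :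
    ((liftGuard h ι g).Eval fun θ => ∃ d, HasValue S w ρ i θ.1 d ∧ HasValue S w ρ i θ.2 d) ↔
      g.Eval fun θ => ∃ d, HasValue S w (fun j r => ρ j (ι r)) i θ.1 d ∧
        HasValue S w (fun j r => ρ j (ι r)) i θ.2 d :=
  BoolFormula.eval_map_iff
    (fun θ => by simp only [Prod.map_fst, Prod.map_snd, hasValue_liftTerm]) g

/-- The register content `x` at position `i` obeys the entry `u` of an update function. -/
def Updates (S : Signature σ A D m) (w : DataWord A D m) (ρ : Fin w.len → R → Option D)
    (i : Fin w.len) (u : Option (({s : σ // P s} × R) ⊕ (Fin m × ℕ))) (x : Option D) : Prop :=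
  match u with
  | none => x = none
  | some (.inl (s, r')) => ∀ j, S.Rel s.1 w j i → x = ρ j r'
  | some (.inr (k, B)) => ∃ j, S.ball w B i j ∧ x = some (w.data j k)

theorem updates_map_liftSource {h : ∀ s, P s → P' s} {ι : R → R'}
    {ρ : Fin w.len → R' → Option D} {i : Fin w.len}
    {u : Option (({s : σ // P s} × R) ⊕ (Fin m × ℕ))} {x : Option D} :
    Updates S w ρ i (u.map (liftSource h ι)) x ↔
      Updates S w (fun j r => ρ j (ι r)) i u x := by
  rcases u with _ | ⟨s, r⟩ | ⟨k, B⟩ <;> exact Iff.rfl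

theorem eq_of_map_liftSource {h : ∀ s, P s → P' s} {ι : R → R'}
    {u : Option (({s : σ // P s} × R) ⊕ (Fin m × ℕ))} {k : Fin m} {B : ℕ}
    (hu : u.map (liftSource h ι) = some (.inr (k, B))) : u = some (.inr (k, B)) := by
  rcases u with _ | ⟨s, r⟩ | ⟨k', B'⟩ <;> cases hu
  rfl

theorem justifies_iff {q : Fin w.len → Q} {ρ : Fin w.len → R → Option D} {i : Fin w.len}
    {t : Transition σ A m Q R} :
    Justifies S w q ρ i t ↔ t.a = w.label i ∧ t.q = q i ∧
      (∀ s, (t.p s).isSome ↔ ∃ j, S.Rel s w j i) ∧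
      (∀ s j, S.Rel s w j i → t.p s = some (q j)) ∧
      (t.g.Eval fun θ => ∃ d, HasValue S w ρ i θ.1 d ∧ HasValue S w ρ i θ.2 d) ∧
      ∀ r, Updates S w ρ i (t.f r) (ρ i r) := by
  constructor
  · rintro ⟨h₁, h₂, h₃, h₄, h₅, h₆, h₇, h₈⟩
    refine ⟨h₁, h₂, h₃, h₄, h₅, fun r => ?_⟩
    rcases hf : t.f r with _ | ⟨s, r'⟩ | ⟨k, B⟩
    · exact h₈ r hf
    · exact h₆ r s r' hf
    · exact h₇ r k B hf
  · rintro ⟨h₁, h₂, h₃, h₄, h₅, h₆⟩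
    refine ⟨h₁, h₂, h₃, h₄, h₅, fun r s r' hf => ?_, fun r k B hf => ?_, fun r hf => ?_⟩
    all_goals
      have := h₆ r
      rw [hf] at this
      exact this

/-! ### Union -/

/-- Regard a transition as one over more states and registers. The partial inverse `κ` of `ι`
tells which registers are original ones; all others are left undefined. -/
def Transition.embed (t : Transition σ A m Q R) (e : Q → Q') (ι : R → R') (κ : R' → Option R) :
    Transition σ A m Q' R' where
  p s := (t.p s).map e
  g := liftGuard (fun s (h : (t.p s).isSome) => by simpa using h) ι t.g
  a := t.a
  q := e t.q
  f r' := (κ r').bind fun r =>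
    (t.f r).map (liftSource (fun s (h : (t.p s).isSome) => by simpa using h) ι)

theorem justifies_embed {q : Fin w.len → Q} {ρ : Fin w.len → R' → Option D} {i : Fin w.len}
    {t : Transition σ A m Q R} {e : Q → Q'} (he : Function.Injective e) {ι : R → R'}
    {κ : R' → Option R} (hκ : Function.IsPartialInv ι κ) :
    Justifies S w (fun j => e (q j)) ρ i (t.embed e ι κ) ↔
      Justifies S w q (fun j r => ρ j (ι r)) i t ∧ ∀ r', κ r' = none → ρ i r' = none := by
  rw [justifies_iff, justifies_iff]
  have hp : ∀ s j, (t.p s).map e = some (e (q j)) ↔ t.p s = some (q j) := fun s j => by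
    rw [← Option.map_some, (Option.map_injective he).eq_iff]
  have hf : (∀ r', Updates S w ρ i ((t.embed e ι κ).f r') (ρ i r')) ↔
      (∀ r, Updates S w (fun j r => ρ j (ι r)) i (t.f r) (ρ i (ι r))) ∧
        ∀ r', κ r' = none → ρ i r' = none := by
    constructor
    · intro H
      refine ⟨fun r => ?_, fun r' hr' => ?_⟩
      · have := H (ι r)
        simp only [Transition.embed, (hκ r (ι r)).2 rfl, Option.bind_some] at this
        exact updates_map_liftSource.1 this
      · have := H r'
        simp only [Transition.embed, hr', Option.bind_none] at this
        exact this
    · rintro ⟨H₁, H₂⟩ r'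
      rcases hr' : κ r' with _ | r
      · simp only [Transition.embed, hr', Option.bind_none]
        exact H₂ r' hr'
      · obtain rfl := (hκ r r').1 hr'
        simp only [Transition.embed, hr', Option.bind_some]
        exact updates_map_liftSource.2 (H₁ r)
  rw [hf]
  simp only [Transition.embed, eval_liftGuard, hp, he.eq_iff, Option.isSome_map, and_assoc]

/-- If the transitions of `Δ'` with a target in the range of `e` are the embedded transitions of
`Δ`, then `Δ` and `Δ'` admit the same sequences of states from the range of `e`. -/
theorem exists_run_embed {Δ : Set (Transition σ A m Q R)} {Δ' : Set (Transition σ A m Q' R')}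
    {e : Q → Q'} (he : Function.Injective e) {ι : R → R'} {κ : R' → Option R}
    (hκ : Function.IsPartialInv ι κ) (h₁ : ∀ t ∈ Δ, t.embed e ι κ ∈ Δ')
    (h₂ : ∀ t' ∈ Δ', ∀ x, t'.q = e x → ∃ t ∈ Δ, t.embed e ι κ = t') {q : Fin w.len → Q} :
    (∃ ρ, ∀ i, ∃ t ∈ Δ', Justifies S w (fun j => e (q j)) ρ i t) ↔
      ∃ ρ, ∀ i, ∃ t ∈ Δ, Justifies S w q ρ i t := by
  constructor
  · rintro ⟨ρ, H⟩
    refine ⟨fun j r => ρ j (ι r), fun i => ?_⟩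
    obtain ⟨t', ht', hJ⟩ := H i
    obtain ⟨t, ht, rfl⟩ := h₂ t' ht' _ hJ.target_eq
    exact ⟨t, ht, ((justifies_embed he hκ).1 hJ).1⟩
  · rintro ⟨ρ, H⟩
    refine ⟨fun j r' => (κ r').bind (ρ j), fun i => ?_⟩
    obtain ⟨t, ht, hJ⟩ := H i
    refine ⟨_, h₁ t ht, (justifies_embed he hκ).2 ⟨?_, fun r' hr' => by simp [hr']⟩⟩
    simpa only [(hκ _ _).2 rfl, Option.bind_some] using hJ

theorem isPartialInv_inl : Function.IsPartialInv (Sum.inl : R₁ → R₁ ⊕ R₂) Sum.getLeft? :=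
  fun r r' => by rw [Sum.getLeft?_eq_some_iff, eq_comm]

theorem isPartialInv_inr : Function.IsPartialInv (Sum.inr : R₂ → R₁ ⊕ R₂) Sum.getRight? :=
  fun r r' => by rw [Sum.getRight?_eq_some_iff, eq_comm]

/-- The disjoint union of two automata, with a given global condition. -/
def Automaton.sum (𝒜₁ 𝒜₂ : Automaton σ A m) (Φ : BoolFormula ((𝒜₁.Q ⊕ 𝒜₂.Q) × ℕ)) :
    Automaton σ A m where
  Q := 𝒜₁.Q ⊕ 𝒜₂.Q
  R := 𝒜₁.R ⊕ 𝒜₂.R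
  finite_Q := have := 𝒜₁.finite_Q; have := 𝒜₂.finite_Q; inferInstance
  finite_R := have := 𝒜₁.finite_R; have := 𝒜₂.finite_R; inferInstance
  Δ := (fun t => t.embed Sum.inl Sum.inl Sum.getLeft?) '' 𝒜₁.Δ ∪
    (fun t => t.embed Sum.inr Sum.inr Sum.getRight?) '' 𝒜₂.Δ
  finite_Δ := (𝒜₁.finite_Δ.image _).union (𝒜₂.finite_Δ.image _)
  F s := Sum.inl '' 𝒜₁.F s ∪ Sum.inr '' 𝒜₂.F s
  Φ := Φ

theorem Automaton.sum_run_inl {𝒜₁ 𝒜₂ : Automaton σ A m} {Φ : BoolFormula ((𝒜₁.Q ⊕ 𝒜₂.Q) × ℕ)}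
    {q : Fin w.len → 𝒜₁.Q} :
    (∃ ρ, (𝒜₁.sum 𝒜₂ Φ).IsRun S w (fun i => .inl (q i)) ρ) ↔ ∃ ρ, 𝒜₁.IsRun S w q ρ := by
  refine exists_run_embed Sum.inl_injective isPartialInv_inl
    (fun t ht => Or.inl ⟨t, ht, rfl⟩) ?_
  rintro t' (⟨t, ht, rfl⟩ | ⟨t, ht, rfl⟩) x hx
  · exact ⟨t, ht, rfl⟩
  · cases hx

theorem Automaton.sum_run_inr {𝒜₁ 𝒜₂ : Automaton σ A m} {Φ : BoolFormula ((𝒜₁.Q ⊕ 𝒜₂.Q) × ℕ)}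
    {q : Fin w.len → 𝒜₂.Q} :
    (∃ ρ, (𝒜₁.sum 𝒜₂ Φ).IsRun S w (fun i => .inr (q i)) ρ) ↔ ∃ ρ, 𝒜₂.IsRun S w q ρ := by
  refine exists_run_embed Sum.inr_injective isPartialInv_inr
    (fun t ht => Or.inr ⟨t, ht, rfl⟩) ?_
  rintro t' (⟨t, ht, rfl⟩ | ⟨t, ht, rfl⟩) x hx
  · cases hx
  · exact ⟨t, ht, rfl⟩

theorem Model.admits_sum {C : Model} {𝒜₁ 𝒜₂ : Automaton σ A m} (h₁ : C.Admits 𝒜₁)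
    (h₂ : C.Admits 𝒜₂) (Φ : BoolFormula ((𝒜₁.Q ⊕ 𝒜₂.Q) × ℕ)) : C.Admits (𝒜₁.sum 𝒜₂ Φ) := by
  cases C with
  | cra => trivial
  | craMinus =>
    rintro _ (⟨t, ht, rfl⟩ | ⟨t, ht, rfl⟩) (r | r) k B hf
    · exact h₁ t ht r k B (eq_of_map_liftSource hf)
    · cases hf
    · cases hf
    · exact h₂ t ht r k B (eq_of_map_liftSource hf)
  | cma =>
    rintro _ (⟨t, ht, rfl⟩ | ⟨t, ht, rfl⟩) (r | r)
    · exact congrArg (Option.map _) (h₁ t ht r)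
    · rfl
    · rfl
    · exact congrArg (Option.map _) (h₂ t ht r)

/-- In the disjoint union, different components of the graph of a word could be processed by
different automata; the global condition makes sure that only one of them is used. -/
theorem Model.union_mem_lang {C : Model} {L₁ L₂ : Set (DataWord A D m)} (h₁ : L₁ ∈ C.Lang S)
    (h₂ : L₂ ∈ C.Lang S) : L₁ ∪ L₂ ∈ C.Lang S := by
  obtain ⟨𝒜₁, hC₁, rfl⟩ := h₁
  obtain ⟨𝒜₂, hC₂, rfl⟩ := h₂
  have := 𝒜₁.finite_Q
  have := 𝒜₂.finite_Q
  obtain ⟨ψ₁, hψ₁⟩ := BoolFormula.exists_eval_count_comp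
    (Sum.isRight : 𝒜₁.Q ⊕ 𝒜₂.Q → Bool) (.atom (true, 0))
  obtain ⟨ψ₂, hψ₂⟩ := BoolFormula.exists_eval_count_comp
    (Sum.isLeft : 𝒜₁.Q ⊕ 𝒜₂.Q → Bool) (.atom (true, 0))
  refine ⟨𝒜₁.sum 𝒜₂ (.or (.and (𝒜₁.Φ.map (Prod.map .inl id)) ψ₁)
    (.and (𝒜₂.Φ.map (Prod.map .inr id)) ψ₂)), Model.admits_sum hC₁ hC₂ _, ?_⟩
  ext w
  constructor
  · rintro ⟨q, ρ, hrun, hF, hΦ⟩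
    change BoolFormula.Eval _ _ ∧ BoolFormula.Eval _ _ ∨
      BoolFormula.Eval _ _ ∧ BoolFormula.Eval _ _ at hΦ
    rcases hΦ with ⟨hΦ, hψ⟩ | ⟨hΦ, hψ⟩
    · replace hψ := (hψ₁ _ q).1 hψ
      have hq : ∀ i, ∃ x, q i = .inl x := fun i => by
        have := (Set.ncard_eq_zero (Set.toFinite _)).1 (Nat.le_zero.1 hψ)
        have hi := Set.eq_empty_iff_forall_notMem.1 this i
        rcases hqi : q i with x | x
        · exact ⟨x, rfl⟩
        · simp [hqi] at hi
      choose q₁ hq₁ using hq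
      obtain rfl : q = fun i => .inl (q₁ i) := funext hq₁
      obtain ⟨ρ₁, hρ₁⟩ := Automaton.sum_run_inl.1 ⟨ρ, hrun⟩
      refine Or.inl ⟨q₁, ρ₁, hρ₁, fun i s h => ?_,
        (BoolFormula.eval_count_map_iff Sum.inl_injective _ _).1 hΦ⟩
      rcases hF i s h with ⟨x, hx, hxi⟩ | ⟨x, hx, hxi⟩ <;> cases hxi
      exact hx
    · replace hψ := (hψ₂ _ q).1 hψ
      have hq : ∀ i, ∃ x, q i = .inr x := fun i => by
        have := (Set.ncard_eq_zero (Set.toFinite _)).1 (Nat.le_zero.1 hψ)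
        have hi := Set.eq_empty_iff_forall_notMem.1 this i
        rcases hqi : q i with x | x
        · simp [hqi] at hi
        · exact ⟨x, rfl⟩
      choose q₂ hq₂ using hq
      obtain rfl : q = fun i => .inr (q₂ i) := funext hq₂
      obtain ⟨ρ₂, hρ₂⟩ := Automaton.sum_run_inr.1 ⟨ρ, hrun⟩
      refine Or.inr ⟨q₂, ρ₂, hρ₂, fun i s h => ?_,
        (BoolFormula.eval_count_map_iff Sum.inr_injective _ _).1 hΦ⟩
      rcases hF i s h with ⟨x, hx, hxi⟩ | ⟨x, hx, hxi⟩ <;> cases hxi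
      exact hx
  · rintro (⟨q, ρ, hrun, hF, hΦ⟩ | ⟨q, ρ, hrun, hF, hΦ⟩)
    · obtain ⟨ρ', hρ'⟩ := Automaton.sum_run_inl.2 ⟨ρ, hrun⟩
      refine ⟨fun i => .inl (q i), ρ', hρ', fun i s h => Or.inl ⟨_, hF i s h, rfl⟩, ?_⟩
      refine Or.inl ⟨(BoolFormula.eval_count_map_iff Sum.inl_injective _ _).2 hΦ, ?_⟩
      exact (hψ₁ _ _).2 (by simp [BoolFormula.Eval])
    · obtain ⟨ρ', hρ'⟩ := Automaton.sum_run_inr.2 ⟨ρ, hrun⟩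
      refine ⟨fun i => .inr (q i), ρ', hρ', fun i s h => Or.inr ⟨_, hF i s h, rfl⟩, ?_⟩
      refine Or.inr ⟨(BoolFormula.eval_count_map_iff Sum.inr_injective _ _).2 hΦ, ?_⟩
      exact (hψ₂ _ _).2 (by simp [BoolFormula.Eval])

/-! ### Intersection -/

/-- The synchronous product of two transitions with the same domain of the source mapping. It acts
on each of the two sets of registers like the respective factor. -/
def Transition.prod (t₁ : Transition σ A m Q₁ R₁) (t₂ : Transition σ A m Q₂ R₂)
    (h : ∀ s, (t₁.p s).isSome ↔ (t₂.p s).isSome) :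
    Transition σ A m (Q₁ × Q₂) (R₁ ⊕ R₂) :=
  have hp : ∀ s, (t₁.p s).isSome → (Option.map₂ Prod.mk (t₁.p s) (t₂.p s)).isSome := fun s hs => by
    obtain ⟨x, hx⟩ := Option.isSome_iff_exists.1 hs
    obtain ⟨y, hy⟩ := Option.isSome_iff_exists.1 ((h s).1 hs)
    simp [hx, hy]
  { p := fun s => Option.map₂ Prod.mk (t₁.p s) (t₂.p s)
    g := .and (liftGuard hp .inl t₁.g)
      (liftGuard (fun s hs => hp s ((h s).2 hs)) .inr t₂.g)
    a := t₁.a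
    q := (t₁.q, t₂.q)
    f := Sum.elim (fun r => (t₁.f r).map (liftSource hp .inl))
      (fun r => (t₂.f r).map (liftSource (fun s hs => hp s ((h s).2 hs)) .inr)) }

theorem justifies_prod {q : Fin w.len → Q₁ × Q₂} {ρ : Fin w.len → R₁ ⊕ R₂ → Option D}
    {i : Fin w.len} {t₁ : Transition σ A m Q₁ R₁} {t₂ : Transition σ A m Q₂ R₂}
    (h : ∀ s, (t₁.p s).isSome ↔ (t₂.p s).isSome) (ha : t₁.a = t₂.a) :
    Justifies S w q ρ i (t₁.prod t₂ h) ↔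
      Justifies S w (fun j => (q j).1) (fun j r => ρ j (.inl r)) i t₁ ∧
        Justifies S w (fun j => (q j).2) (fun j r => ρ j (.inr r)) i t₂ := by
  simp only [justifies_iff]
  have hp : ∀ s j, Option.map₂ Prod.mk (t₁.p s) (t₂.p s) = some (q j) ↔
      t₁.p s = some (q j).1 ∧ t₂.p s = some (q j).2 := fun s j => by
    rcases t₁.p s <;> rcases t₂.p s <;> simp [Prod.ext_iff]
  have hd : ∀ s, (Option.map₂ Prod.mk (t₁.p s) (t₂.p s)).isSome ↔ (t₁.p s).isSome := fun s => by
    have := h s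
    rcases h₁ : t₁.p s <;> rcases h₂ : t₂.p s <;> simp_all
  simp only [Transition.prod, BoolFormula.Eval, eval_liftGuard, hp, hd, Sum.forall, Sum.elim_inl,
    Sum.elim_inr, updates_map_liftSource, Prod.ext_iff, ← h, ← ha]
  constructor
  · rintro ⟨h₁, ⟨h₂, h₂'⟩, h₃, h₄, ⟨h₅, h₅'⟩, h₆, h₆'⟩
    exact ⟨⟨h₁, h₂, h₃, fun s j hj => (h₄ s j hj).1, h₅, h₆⟩,
      h₁, h₂', h₃, fun s j hj => (h₄ s j hj).2, h₅', h₆'⟩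
  · rintro ⟨⟨h₁, h₂, h₃, h₄, h₅, h₆⟩, -, h₂', -, h₄', h₅', h₆'⟩
    exact ⟨h₁, ⟨h₂, h₂'⟩, h₃, fun s j hj => ⟨h₄ s j hj, h₄' s j hj⟩, ⟨h₅, h₅'⟩, h₆, h₆'⟩

/-- The synchronous product of two automata, with a given global condition. -/
def Automaton.prod (𝒜₁ 𝒜₂ : Automaton σ A m) (Φ : BoolFormula ((𝒜₁.Q × 𝒜₂.Q) × ℕ)) :
    Automaton σ A m where
  Q := 𝒜₁.Q × 𝒜₂.Q
  R := 𝒜₁.R ⊕ 𝒜₂.R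
  finite_Q := have := 𝒜₁.finite_Q; have := 𝒜₂.finite_Q; inferInstance
  finite_R := have := 𝒜₁.finite_R; have := 𝒜₂.finite_R; inferInstance
  Δ := ⋃ t₁ ∈ 𝒜₁.Δ, ⋃ t₂ ∈ 𝒜₂.Δ, {t | t₁.a = t₂.a ∧ ∃ h, t = t₁.prod t₂ h}
  finite_Δ := 𝒜₁.finite_Δ.biUnion fun t₁ _ => 𝒜₂.finite_Δ.biUnion fun t₂ _ =>
    Set.Subsingleton.finite (by rintro _ ⟨-, h, rfl⟩ _ ⟨-, h', rfl⟩; rfl)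
  F s := 𝒜₁.F s ×ˢ 𝒜₂.F s
  Φ := Φ

theorem Automaton.mem_prod_Δ {𝒜₁ 𝒜₂ : Automaton σ A m} {Φ : BoolFormula ((𝒜₁.Q × 𝒜₂.Q) × ℕ)}
    {t : Transition σ A m (𝒜₁.Q × 𝒜₂.Q) (𝒜₁.R ⊕ 𝒜₂.R)} :
    t ∈ (𝒜₁.prod 𝒜₂ Φ).Δ ↔
      ∃ t₁ ∈ 𝒜₁.Δ, ∃ t₂ ∈ 𝒜₂.Δ, t₁.a = t₂.a ∧ ∃ h, t = t₁.prod t₂ h := by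
  constructor
  · intro h
    obtain ⟨t₁, h₁, h⟩ := Set.mem_iUnion₂.1 h
    obtain ⟨t₂, h₂, h⟩ := Set.mem_iUnion₂.1 h
    exact ⟨t₁, h₁, t₂, h₂, h⟩
  · rintro ⟨t₁, h₁, t₂, h₂, h⟩
    exact Set.mem_iUnion₂.2 ⟨t₁, h₁, Set.mem_iUnion₂.2 ⟨t₂, h₂, h⟩⟩

theorem Automaton.prod_run {𝒜₁ 𝒜₂ : Automaton σ A m} {Φ : BoolFormula ((𝒜₁.Q × 𝒜₂.Q) × ℕ)}
    {q : Fin w.len → 𝒜₁.Q × 𝒜₂.Q} {ρ : Fin w.len → 𝒜₁.R ⊕ 𝒜₂.R → Option D} :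
    (𝒜₁.prod 𝒜₂ Φ).IsRun S w q ρ ↔
      𝒜₁.IsRun S w (fun j => (q j).1) (fun j r => ρ j (.inl r)) ∧
        𝒜₂.IsRun S w (fun j => (q j).2) (fun j r => ρ j (.inr r)) := by
  constructor
  · intro H
    refine ⟨fun i => ?_, fun i => ?_⟩ <;>
    · obtain ⟨t, ht, hJ⟩ := H i
      obtain ⟨t₁, ht₁, t₂, ht₂, ha, h, rfl⟩ := Automaton.mem_prod_Δ.1 ht
      have := (justifies_prod h ha).1 hJ
      first
        | exact ⟨t₁, ht₁, this.1⟩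
        | exact ⟨t₂, ht₂, this.2⟩
  · rintro ⟨H₁, H₂⟩ i
    obtain ⟨t₁, ht₁, hJ₁⟩ := H₁ i
    obtain ⟨t₂, ht₂, hJ₂⟩ := H₂ i
    have ha : t₁.a = t₂.a := hJ₁.label_eq.trans hJ₂.label_eq.symm
    have h : ∀ s, (t₁.p s).isSome ↔ (t₂.p s).isSome := fun s =>
      (hJ₁.dom_iff s).trans (hJ₂.dom_iff s).symm
    exact ⟨t₁.prod t₂ h, Automaton.mem_prod_Δ.2 ⟨t₁, ht₁, t₂, ht₂, ha, h, rfl⟩,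
      (justifies_prod h ha).2 ⟨hJ₁, hJ₂⟩⟩

theorem Model.admits_prod {C : Model} {𝒜₁ 𝒜₂ : Automaton σ A m} (h₁ : C.Admits 𝒜₁)
    (h₂ : C.Admits 𝒜₂) (Φ : BoolFormula ((𝒜₁.Q × 𝒜₂.Q) × ℕ)) : C.Admits (𝒜₁.prod 𝒜₂ Φ) := by
  cases C with
  | cra => trivial
  | craMinus =>
    intro t ht r k B hf
    obtain ⟨t₁, ht₁, t₂, ht₂, -, h, rfl⟩ := Automaton.mem_prod_Δ.1 ht
    rcases r with r | r
    · exact h₁ t₁ ht₁ r k B (eq_of_map_liftSource hf)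
    · exact h₂ t₂ ht₂ r k B (eq_of_map_liftSource hf)
  | cma =>
    intro t ht r
    obtain ⟨t₁, ht₁, t₂, ht₂, -, h, rfl⟩ := Automaton.mem_prod_Δ.1 ht
    rcases r with r | r
    · exact congrArg (Option.map _) (h₁ t₁ ht₁ r)
    · exact congrArg (Option.map _) (h₂ t₂ ht₂ r)

theorem Model.inter_mem_lang {C : Model} {L₁ L₂ : Set (DataWord A D m)} (h₁ : L₁ ∈ C.Lang S)
    (h₂ : L₂ ∈ C.Lang S) : L₁ ∩ L₂ ∈ C.Lang S := by
  obtain ⟨𝒜₁, hC₁, rfl⟩ := h₁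
  obtain ⟨𝒜₂, hC₂, rfl⟩ := h₂
  have := 𝒜₁.finite_Q
  have := 𝒜₂.finite_Q
  obtain ⟨ψ₁, hψ₁⟩ := BoolFormula.exists_eval_count_comp
    (Prod.fst : 𝒜₁.Q × 𝒜₂.Q → 𝒜₁.Q) 𝒜₁.Φ
  obtain ⟨ψ₂, hψ₂⟩ := BoolFormula.exists_eval_count_comp
    (Prod.snd : 𝒜₁.Q × 𝒜₂.Q → 𝒜₂.Q) 𝒜₂.Φ
  refine ⟨𝒜₁.prod 𝒜₂ (.and ψ₁ ψ₂), Model.admits_prod hC₁ hC₂ _, ?_⟩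
  ext w
  constructor
  · rintro ⟨q, ρ, hrun, hF, hΦ₁, hΦ₂⟩
    obtain ⟨hr₁, hr₂⟩ := Automaton.prod_run.1 hrun
    exact ⟨⟨_, _, hr₁, fun i s h => (hF i s h).1, (hψ₁ _ _).1 hΦ₁⟩,
      _, _, hr₂, fun i s h => (hF i s h).2, (hψ₂ _ _).1 hΦ₂⟩
  · rintro ⟨⟨q₁, ρ₁, hr₁, hF₁, hΦ₁⟩, q₂, ρ₂, hr₂, hF₂, hΦ₂⟩
    exact ⟨fun i => (q₁ i, q₂ i), fun i => Sum.elim (ρ₁ i) (ρ₂ i),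
      Automaton.prod_run.2 ⟨hr₁, hr₂⟩, fun i s h => ⟨hF₁ i s h, hF₂ i s h⟩,
      (hψ₁ _ _).2 hΦ₁, (hψ₂ _ _).2 hΦ₂⟩

end Lift

/-! ### Projection -/

section Projection

variable {σ : Type w} {A : Type v} {D : Type u} {m : ℕ} {Γ : Type x}

/-- Forget the `Γ`-component of the label of a transition. -/
def Transition.proj {Q R : Type} (t : Transition σ (A × Γ) m Q R) : Transition σ A m Q R where
  p := t.p
  g := t.g
  a := t.a.1
  q := t.q
  f := t.f

/-- Forget the `Γ`-components of the labels of all transitions. -/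
def Automaton.proj (𝒜 : Automaton σ (A × Γ) m) : Automaton σ A m where
  Q := 𝒜.Q
  R := 𝒜.R
  finite_Q := 𝒜.finite_Q
  finite_R := 𝒜.finite_R
  Δ := Transition.proj '' 𝒜.Δ
  finite_Δ := 𝒜.finite_Δ.image _
  F := 𝒜.F
  Φ := 𝒜.Φ

theorem Model.proj_image_mem_lang {C : Model} {S : Signature σ A D m}
    {L : Set (DataWord (A × Γ) D m)} (h : L ∈ C.Lang (S.extend Γ)) :
    DataWord.proj '' L ∈ C.Lang S := by
  obtain ⟨𝒜, hC, rfl⟩ := h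
  refine ⟨𝒜.proj, ?_, ?_⟩
  · cases C with
    | cra => trivial
    | craMinus =>
      rintro _ ⟨t, ht, rfl⟩ r k B hf
      exact hC t ht r k B hf
    | cma =>
      rintro _ ⟨t, ht, rfl⟩ r
      exact hC t ht r
  ext w
  constructor
  · rintro ⟨q, ρ, hrun, hF, hΦ⟩
    have hrun' : ∀ i, ∃ t ∈ 𝒜.Δ, Justifies S w q ρ i t.proj := fun i => by
      obtain ⟨_, ⟨t, ht, rfl⟩, hJ⟩ := hrun i
      exact ⟨t, ht, hJ⟩
    choose t ht hJ using hrun'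
    -- the letters from `Γ` are those read by the transitions of the run
    refine ⟨⟨w.len, fun i => (((w.get i).1, (t i).a.2), (w.get i).2)⟩,
      ⟨q, ρ, fun i => ⟨t i, ht i, ?_⟩, hF, hΦ⟩, rfl⟩
    exact ⟨Prod.ext (hJ i).label_eq rfl, (hJ i).target_eq, (hJ i).dom_iff, (hJ i).source_eq,
      (hJ i).guard, (hJ i).update_copy, (hJ i).update_guess, (hJ i).update_undef⟩
  · rintro ⟨w, ⟨q, ρ, hrun, hF, hΦ⟩, rfl⟩
    refine ⟨q, ρ, fun i => ?_, hF, hΦ⟩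
    obtain ⟨t, ht, hJ⟩ := hrun i
    exact ⟨t.proj, ⟨t, ht, rfl⟩, congrArg Prod.fst hJ.label_eq, hJ.target_eq, hJ.dom_iff,
      hJ.source_eq, hJ.guard, hJ.update_copy, hJ.update_guess, hJ.update_undef⟩

end Projection

/-! ### A signature of pairs of square pictures -/

/-- The symbols for the grid structure on pairs of square pictures. -/
inductive GridSymbol
  | row
  | col
  | diag

theorem GridSymbol.finite : Finite GridSymbol :=
  Set.finite_univ_iff.1 ((Set.toFinite {.row, .col, .diag}).subset (by rintro (_ | _ | _) <;> simp))

/-- The numbers below `2 * (n * n)` are read as the cells of two pictures with `n` rows and `n`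
columns, one row after the other. Neighbouring cells of the same row and neighbouring cells of the
same column are related. The only relation between the two pictures connects the cells with the
same position on the main diagonal. -/
def gridRel (n : ℕ) : GridSymbol → ℕ → ℕ → Prop
  | .row, i, j => j = i + 1 ∧ i / n = j / n
  | .col, i, j => j = i + n ∧ 0 < n ∧ (i < n * n ↔ j < n * n)
  | .diag, i, j => j = i + n * n ∧ 0 < n ∧ i < n * n ∧ i / n = i % n

/-- Within each of the relations, the difference of related positions is a constant. -/
theorem exists_gridRel_shift (n : ℕ) (s : GridSymbol) :
    ∃ k, ∀ i j, gridRel n s i j → j = i + k ∧ 0 < k := by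
  rcases s with _ | _ | _
  · exact ⟨1, fun i j h => ⟨h.1, one_pos⟩⟩
  · exact ⟨n, fun i j h => ⟨h.1, h.2.1⟩⟩
  · exact ⟨n * n, fun i j h => ⟨h.1, Nat.mul_pos h.2.1 h.2.1⟩⟩

/-- Words over `Bool` of length `2 * (n * n)` are pairs of pictures. On words of other lengths the
side of the pictures is rounded down, which does not matter in the sequel. -/
def gridSignature (D : Type u) (m : ℕ) : Signature GridSymbol Bool D m where
  Rel s w i j := gridRel (Nat.sqrt (w.len / 2)) s i j
  lt_of_rel s w i j h := by
    obtain ⟨k, hk⟩ := exists_gridRel_shift (Nat.sqrt (w.len / 2)) s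
    have := hk _ _ h
    exact Fin.lt_def.2 (by omega)
  out_unique s w i j j' h h' := by
    obtain ⟨k, hk⟩ := exists_gridRel_shift (Nat.sqrt (w.len / 2)) s
    have := hk _ _ h
    have := hk _ _ h'
    exact Fin.ext (by omega)
  in_unique s w i j j' h h' := by
    obtain ⟨k, hk⟩ := exists_gridRel_shift (Nat.sqrt (w.len / 2)) s
    have := hk _ _ h
    have := hk _ _ h'
    exact Fin.ext (by omega)
  monotone s w i j i' j' h h' _ _ := by
    obtain ⟨k, hk⟩ := exists_gridRel_shift (Nat.sqrt (w.len / 2)) s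
    have := hk _ _ h
    have := hk _ _ h'
    rw [Fin.lt_def, Fin.lt_def]
    omega

section Pictures

variable {D : Type u} {m n : ℕ}

/-- The word that describes two pictures, with all data values equal to `d`. -/
abbrev pictureWord (m : ℕ) (d : D) (P P' : Fin (n * n) → Bool) : DataWord Bool D m where
  len := 2 * (n * n)
  get i := (if h : i < n * n then P ⟨i, h⟩ else P' ⟨i - n * n, by omega⟩, fun _ => d)

theorem gridSignature_rel_pictureWord {d : D} {P P' : Fin (n * n) → Bool} {s : GridSymbol}
    {i j : Fin (2 * (n * n))} :
    (gridSignature D m).Rel s (pictureWord m d P P') i j ↔ gridRel n s i j := by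
  have : Nat.sqrt (2 * (n * n) / 2) = n := by
    rw [Nat.mul_div_cancel_left _ two_pos, Nat.sqrt_eq]
  simp only [gridSignature, this]

theorem mul_add_div_of_lt {a j : ℕ} (h : j < n) : (a * n + j) / n = a := by
  rw [mul_comm, Nat.mul_add_div (by omega), Nat.div_eq_of_lt h, add_zero]

theorem mul_add_mod_of_lt {a j : ℕ} (h : j < n) : (a * n + j) % n = j := by
  rw [mul_comm, Nat.mul_add_mod, Nat.mod_eq_of_lt h]

theorem mul_add_lt {a b j : ℕ} (ha : a < b) (h : j < n) : a * n + j < b * n :=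
  calc a * n + j < (a + 1) * n := by rw [Nat.succ_mul]; omega
    _ ≤ b * n := Nat.mul_le_mul_right n ha

/-- A function that is constant along rows and diagonal links agrees on corresponding cells of the
two pictures. -/
theorem eq_of_row_of_diag {f : ℕ → Bool}
    (hrow : ∀ i j, j < 2 * (n * n) → gridRel n .row i j → f i = f j)
    (hdiag : ∀ i j, j < 2 * (n * n) → gridRel n .diag i j → f i = f j) {x : ℕ} (hx : x < n * n) :
    f x = f (x + n * n) := by
  have hn : 0 < n := Nat.pos_of_ne_zero (by rintro rfl; omega)
  have key : ∀ a, a < 2 * n → ∀ j, j < n → f (a * n) = f (a * n + j) := by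
    intro a ha j
    induction j with
    | zero => intro _; rfl
    | succ j ih =>
      intro hj
      have := mul_add_lt ha hj
      refine (ih (by omega)).trans (hrow _ _ (by rwa [← mul_assoc]) ⟨rfl, ?_⟩)
      rw [mul_add_div_of_lt hj, mul_add_div_of_lt (by omega)]
  have hi : x / n < n := Nat.div_lt_of_lt_mul hx
  have hj : x % n < n := Nat.mod_lt _ hn
  have hxe : x / n * n + x % n = x := Nat.div_add_mod' x n
  have hlt := mul_add_lt hi hi
  have h₁ := key (x / n) (by omega) (x / n) hi
  have h₂ := key (x / n) (by omega) (x % n) hj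
  have h₃ := key (x / n + n) (by omega) (x / n) hi
  have h₄ := key (x / n + n) (by omega) (x % n) hj
  have h₅ := hdiag (x / n * n + x / n) (x / n * n + x / n + n * n) (by omega)
    ⟨rfl, hn, hlt, by rw [mul_add_div_of_lt hi, mul_add_mod_of_lt hi]⟩
  rw [add_mul] at h₃ h₄
  rw [add_right_comm] at h₃ h₄
  rw [hxe] at h₂ h₄
  rw [← h₂, h₁, h₅, ← h₃, h₄]

/-- A function that is constant along columns and diagonal links agrees on corresponding cells of
the two pictures. -/
theorem eq_of_col_of_diag {f : ℕ → Bool}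
    (hcol : ∀ i j, j < 2 * (n * n) → gridRel n .col i j → f i = f j)
    (hdiag : ∀ i j, j < 2 * (n * n) → gridRel n .diag i j → f i = f j) {x : ℕ} (hx : x < n * n) :
    f x = f (x + n * n) := by
  have hn : 0 < n := Nat.pos_of_ne_zero (by rintro rfl; omega)
  have key : ∀ j, j < n → ∀ i, i < n →
      f j = f (i * n + j) ∧ f (j + n * n) = f (i * n + j + n * n) := by
    intro j hj i
    induction i with
    | zero => intro _; simp
    | succ i ih =>
      intro hi
      have h₁ := mul_add_lt hi hj
      have h₂ : (i + 1) * n + j = i * n + j + n := by ring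
      obtain ⟨e₁, e₂⟩ := ih (by omega)
      refine ⟨e₁.trans (hcol _ _ (by omega) ⟨h₂, hn, ?_⟩),
        e₂.trans (hcol _ _ (by omega) ⟨by omega, hn, ?_⟩)⟩ <;> omega
  have hi : x / n < n := Nat.div_lt_of_lt_mul hx
  have hj : x % n < n := Nat.mod_lt _ hn
  have hxe : x / n * n + x % n = x := Nat.div_add_mod' x n
  have hlt := mul_add_lt hj hj
  obtain ⟨h₁, h₂⟩ := key (x % n) hj (x / n) hi
  obtain ⟨h₃, h₄⟩ := key (x % n) hj (x % n) hj
  have h₅ := hdiag (x % n * n + x % n) (x % n * n + x % n + n * n) (by omega)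
    ⟨rfl, hn, hlt, by rw [mul_add_div_of_lt hj, mul_add_mod_of_lt hj]⟩
  rw [hxe] at h₁ h₂
  rw [← h₁, h₃, h₅, ← h₄, h₂]

/-! ### A class memory automaton that compares pictures -/

/-- A state consists of a bit that marks rows, a bit that marks columns, and the current label.
The bits are passed on along the rows and columns, respectively, and both through the links between
the diagonals. -/
def MarkCompatible : GridSymbol → Bool × Bool × Bool → Bool × Bool × Bool → Prop
  | .row, x, y => x.1 = y.1
  | .col, x, y => x.2.1 = y.2.1
  | .diag, x, y => x.1 = y.1 ∧ x.2.1 = y.2.1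

/-- The transition from the source states `p` to the state `q`. -/
def markTransition (m : ℕ) (p : GridSymbol → Option (Bool × Bool × Bool)) (q : Bool × Bool × Bool) :
    Transition GridSymbol Bool m (Bool × Bool × Bool) Empty where
  p := p
  g := .tt
  a := q.2.2
  q := q
  f _ := none

/-- The automaton that requires exactly one cell with label `false` in the intersection of the
marked rows and columns. -/
def markAutomaton (m : ℕ) : Automaton GridSymbol Bool m where
  Q := Bool × Bool × Bool
  R := Empty
  finite_Q := inferInstance
  finite_R := inferInstance
  Δ := {t | ∃ p q, (∀ s x, p s = some x → MarkCompatible s x q) ∧ t = markTransition m p q}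
  finite_Δ := by
    have := GridSymbol.finite
    refine (Set.finite_range fun x : (GridSymbol → Option (Bool × Bool × Bool)) ×
      (Bool × Bool × Bool) => markTransition m x.1 x.2).subset ?_
    rintro _ ⟨p, q, -, rfl⟩
    exact ⟨(p, q), rfl⟩
  F _ := Set.univ
  Φ := .and (.atom ((true, true, false), 1)) (.neg (.atom ((true, true, false), 0)))

theorem mem_markAutomaton_language {S : Signature GridSymbol Bool D m} {w : DataWord Bool D m} :
    w ∈ (markAutomaton m).language S ↔ ∃ q : Fin w.len → Bool × Bool × Bool,
      (∀ i, (q i).2.2 = w.label i) ∧ (∀ s i j, S.Rel s w i j → MarkCompatible s (q i) (q j)) ∧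
        {i | q i = (true, true, false)}.ncard = 1 := by
  classical
  constructor
  · rintro ⟨q, ρ, hrun, -, h₁, h₂⟩
    refine ⟨q, fun i => ?_, fun s i j hij => ?_, ?_⟩
    · obtain ⟨_, ⟨p, q', -, rfl⟩, hJ⟩ := hrun i
      exact (congrArg (fun x => x.2.2) hJ.target_eq).symm.trans hJ.label_eq
    · obtain ⟨_, ⟨p, q', hp, rfl⟩, hJ⟩ := hrun j
      have := hp s _ (hJ.source_eq s i hij)
      rwa [show q' = q j from hJ.target_eq] at this
    · exact le_antisymm h₁ (Nat.pos_of_ne_zero fun h => h₂ (Nat.le_of_eq h))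
  · rintro ⟨q, hlabel, hcomp, hcard⟩
    refine ⟨q, fun _ r => r.elim, fun i => ?_, fun _ _ _ => trivial, Nat.le_of_eq hcard,
      fun h => ?_⟩
    · have hp : ∀ s, ∃ x : Option (Bool × Bool × Bool), (x.isSome ↔ ∃ j, S.Rel s w j i) ∧
          ∀ j, S.Rel s w j i → x = some (q j) := by
        intro s
        by_cases h : ∃ j, S.Rel s w j i
        · obtain ⟨j, hj⟩ := h
          exact ⟨some (q j), ⟨fun _ => ⟨j, hj⟩, fun _ => rfl⟩,
            fun j' hj' => by rw [S.in_unique s w i j j' hj hj']⟩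
        · exact ⟨none, ⟨fun h' => by simp at h', fun h' => (h h').elim⟩,
            fun j hj => (h ⟨j, hj⟩).elim⟩
      choose p hp₁ hp₂ using hp
      refine ⟨markTransition m p (q i), ⟨p, q i, fun s x hx => ?_, rfl⟩, hlabel i, rfl, hp₁, hp₂,
        trivial, fun r => r.elim, fun r => r.elim, fun r => r.elim⟩
      obtain ⟨j, hj⟩ := (hp₁ s).1 (by rw [hx]; rfl)
      obtain rfl : q j = x := Option.some_injective _ ((hp₂ s j hj).symm.trans hx)
      exact hcomp s j i hj
    · have : {i | q i = (true, true, false)}.ncard ≤ 0 := h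
      omega

/-- In a pair of equal pictures, marked cells with label `false` come in pairs. -/
theorem pictureWord_self_notMem {d : D} {P : Fin (n * n) → Bool} :
    pictureWord m d P P ∉ (markAutomaton m).language (gridSignature D m) := by
  rw [mem_markAutomaton_language]
  rintro ⟨q, hlabel, hcomp, hcard⟩
  have hlen : (pictureWord m d P P).len = 2 * (n * n) := rfl
  obtain ⟨x, hx⟩ := Set.ncard_eq_one.1 hcard
  -- the cell that corresponds to `x` in the other picture is marked as well
  suffices ∃ y, y ≠ x ∧ q y = (true, true, false) by
    obtain ⟨y, hyx, hy⟩ := this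
    have : y ∈ ({x} : Set _) := hx ▸ hy
    exact hyx this
  have hqx : q x = (true, true, false) := by
    have : x ∈ {i | q i = (true, true, false)} := hx ▸ rfl
    exact this
  have hcomp' : ∀ s (i j : Fin (2 * (n * n))), gridRel n s i j → MarkCompatible s (q i) (q j) :=
    fun s i j h => hcomp s i j (gridSignature_rel_pictureWord.2 h)
  have hlt : ∀ s i j, gridRel n s i j → j < 2 * (n * n) → i < 2 * (n * n) := fun s i j h hj => by
    obtain ⟨k, hk⟩ := exists_gridRel_shift n s
    have := hk i j h
    omega
  have key : ∀ (y : ℕ) (hy : y < n * n),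
      q ⟨y, by omega⟩ = q ⟨y + n * n, by omega⟩ := by
    intro y hy
    have h₁ := eq_of_row_of_diag (n := n)
      (f := fun i => if h : i < 2 * (n * n) then (q ⟨i, h⟩).1 else false)
      (fun i j hj h => by
        rw [dif_pos (hlt _ i j h hj), dif_pos hj]
        exact hcomp' .row ⟨i, hlt _ i j h hj⟩ ⟨j, hj⟩ h)
      (fun i j hj h => by
        rw [dif_pos (hlt _ i j h hj), dif_pos hj]
        exact (hcomp' .diag ⟨i, hlt _ i j h hj⟩ ⟨j, hj⟩ h).1) hy
    have h₂ := eq_of_col_of_diag (n := n)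
      (f := fun i => if h : i < 2 * (n * n) then (q ⟨i, h⟩).2.1 else false)
      (fun i j hj h => by
        rw [dif_pos (hlt _ i j h hj), dif_pos hj]
        exact hcomp' .col ⟨i, hlt _ i j h hj⟩ ⟨j, hj⟩ h)
      (fun i j hj h => by
        rw [dif_pos (hlt _ i j h hj), dif_pos hj]
        exact (hcomp' .diag ⟨i, hlt _ i j h hj⟩ ⟨j, hj⟩ h).2) hy
    rw [dif_pos (by omega), dif_pos (by omega)] at h₁ h₂
    refine Prod.ext h₁ (Prod.ext h₂ ?_)
    rw [hlabel, hlabel]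
    simp [DataWord.label, hy]
  by_cases hxn : (x : ℕ) < n * n
  · exact ⟨⟨x + n * n, by omega⟩, fun h => by have := Fin.ext_iff.1 h; dsimp only at this; omega,
      (key x hxn).symm.trans hqx⟩
  · refine ⟨⟨x - n * n, by omega⟩, fun h => by have := Fin.ext_iff.1 h; dsimp only at this; omega, ?_⟩
    rw [key _ (by omega), ← hqx]
    exact congrArg q (Fin.ext (by simp; omega))

theorem pictureWord_mem_of_ne {d : D} {P P' : Fin (n * n) → Bool} (hP : P ≠ P') :
    pictureWord m d P P' ∈ (markAutomaton m).language (gridSignature D m) := by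
  rw [mem_markAutomaton_language]
  obtain ⟨⟨x, hx⟩, hne⟩ := Function.ne_iff.1 hP
  have hn : 0 < n := Nat.pos_of_ne_zero (by rintro rfl; omega)
  have hlen : (pictureWord m d P P').len = 2 * (n * n) := rfl
  -- mark the row and the column of a cell where the pictures differ
  refine ⟨fun i => (decide ((i : ℕ) / n % n = x / n), decide ((i : ℕ) % n = x % n),
    (pictureWord m d P P').label i), fun i => rfl, ?_, ?_⟩
  · intro s i j h
    rw [gridSignature_rel_pictureWord] at h
    rcases s with _ | _ | _
    · simp only [MarkCompatible, h.2]
    · simp only [MarkCompatible, h.1, Nat.add_mod_right]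
    · simp only [MarkCompatible, h.1, Nat.add_mul_div_left _ _ hn, Nat.add_mod_right,
        Nat.add_mul_mod_self_left, and_self]
  · have hcell : ∀ i : ℕ, i < 2 * (n * n) →
        (i / n % n = x / n ∧ i % n = x % n ↔ i = x ∨ i = x + n * n) := by
      intro i hi
      constructor
      · rintro ⟨h₁, h₂⟩
        have h₃ : i % (n * n) = x := by
          rw [Nat.mod_mul, h₁, h₂, Nat.mod_add_div]
        have h₄ := Nat.mod_add_div i (n * n)
        have h₅ : i / (n * n) < 2 := Nat.div_lt_of_lt_mul (by omega)
        rcases Nat.lt_succ_iff_lt_or_eq.1 h₅ with h | h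
        · rw [Nat.lt_one_iff.1 h] at h₄
          omega
        · rw [h] at h₄
          omega
      · have : x / n < n := Nat.div_lt_of_lt_mul hx
        rintro (rfl | rfl)
        · exact ⟨Nat.mod_eq_of_lt this, rfl⟩
        · rw [Nat.add_mul_div_left _ _ hn, Nat.add_mod_right, Nat.add_mul_mod_self_left]
          exact ⟨Nat.mod_eq_of_lt this, rfl⟩
    have hlabel₁ : (pictureWord m d P P').label ⟨x, by omega⟩ = P ⟨x, hx⟩ := by
      simp [DataWord.label, hx]
    have hlabel₂ : (pictureWord m d P P').label ⟨x + n * n, by omega⟩ = P' ⟨x, hx⟩ := by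
      simp [DataWord.label]
    rw [Set.ncard_eq_one]
    have hset : ∀ i : Fin (2 * (n * n)),
        (decide ((i : ℕ) / n % n = x / n), decide ((i : ℕ) % n = x % n),
          (pictureWord m d P P').label i) = (true, true, false) ↔
        (i = ⟨x, by omega⟩ ∨ i = ⟨x + n * n, by omega⟩) ∧
          (pictureWord m d P P').label i = false := by
      intro i
      rw [Fin.ext_iff, Fin.ext_iff, ← hcell i i.2]
      simp [and_assoc]
    rcases hPx : P ⟨x, hx⟩ with _ | _
    · refine ⟨⟨x, by omega⟩, Set.ext fun i => (hset i).trans ⟨?_, ?_⟩⟩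
      · rintro ⟨rfl | rfl, h⟩
        · rfl
        · rw [hlabel₂] at h
          exact (hne (hPx.trans h.symm)).elim
      · rintro rfl
        exact ⟨Or.inl rfl, hlabel₁.trans hPx⟩
    · refine ⟨⟨x + n * n, by omega⟩, Set.ext fun i => (hset i).trans ⟨?_, ?_⟩⟩
      · rintro ⟨rfl | rfl, h⟩
        · rw [hlabel₁, hPx] at h
          cases h
        · rfl
      · rintro rfl
        refine ⟨Or.inr rfl, hlabel₂.trans ?_⟩
        rw [hPx] at hne
        simpa using hne.symm

end Pictures

/-! ### No automaton recognizes equality of pictures -/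

section Mixing

variable {σ : Type w} {A : Type v} {D : Type u} {m n : ℕ} {Q R : Type}

/-- On a word with a single data value, registers cannot contain anything else. -/
theorem Automaton.IsRun.register_eq {𝒜 : Automaton σ A m} {S : Signature σ A D m}
    {w : DataWord A D m} {q : Fin w.len → 𝒜.Q} {ρ : Fin w.len → 𝒜.R → Option D}
    (hrun : 𝒜.IsRun S w q ρ) {d : D} (hd : ∀ i k, w.data i k = d) (i : Fin w.len) :
    ∀ r x, ρ i r = some x → x = d := by
  induction i using WellFoundedLT.induction with
  | ind i ih =>
    intro r x hx
    obtain ⟨t, -, hJ⟩ := hrun i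
    rcases hf : t.f r with _ | ⟨s, r'⟩ | ⟨k, B⟩
    · rw [hJ.update_undef r hf] at hx
      cases hx
    · obtain ⟨j, hj⟩ := (hJ.dom_iff s.1).1 s.2
      rw [hJ.update_copy r s r' hf j hj] at hx
      exact ih j (S.lt_of_rel _ _ _ _ hj) r' x hx
    · obtain ⟨j, -, hj⟩ := hJ.update_guess r k B hf
      rw [hj, hd] at hx
      exact (Option.some_injective _ hx).symm

/-- Whether a transition is justified at a position depends, on words with a single data value,
only on the configurations at this position and at its predecessors. -/
theorem Justifies.transfer {S : Signature σ A D m} {w w' : DataWord A D m} {q : Fin w.len → Q}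
    {ρ : Fin w.len → R → Option D} {q' : Fin w'.len → Q} {ρ' : Fin w'.len → R → Option D}
    {i : Fin w.len} {i' : Fin w'.len} {t : Transition σ A m Q R} (hJ : Justifies S w q ρ i t)
    {d : D} (hd : ∀ i k, w.data i k = d) (hd' : ∀ i k, w'.data i k = d)
    (hlabel : w.label i = w'.label i') (hq : q i = q' i') (hρ : ρ i = ρ' i')
    (hdom : ∀ s, (∃ j, S.Rel s w j i) → ∃ j, S.Rel s w' j i')
    (hprev : ∀ s j', S.Rel s w' j' i' → ∃ j, S.Rel s w j i ∧ q j = q' j' ∧ ρ j = ρ' j') :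
    Justifies S w' q' ρ' i' t := by
  have hvalue : ∀ {P : σ → Prop} (θ : Fin m ⊕ {s : σ // P s} × R) (x : D),
      HasValue S w' ρ' i' θ x ↔ HasValue S w ρ i θ x := by
    rintro P (k | ⟨s, r⟩) x
    · simp only [HasValue, hd, hd']
    · constructor
      · rintro ⟨j', hj', h⟩
        obtain ⟨j, hj, -, h'⟩ := hprev _ _ hj'
        exact ⟨j, hj, h' ▸ h⟩
      · rintro ⟨j, hj, h⟩
        obtain ⟨j', hj'⟩ := hdom _ ⟨j, hj⟩
        obtain ⟨j₂, hj₂, -, h'⟩ := hprev _ _ hj'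
        obtain rfl := S.in_unique _ _ _ _ _ hj hj₂
        exact ⟨j', hj', h' ▸ h⟩
  refine ⟨hJ.label_eq.trans hlabel, hJ.target_eq.trans hq, fun s => ?_, fun s j' hj' => ?_, ?_,
    fun r s r' hf j' hj' => ?_, fun r k B hf => ?_, fun r hf => ?_⟩
  · refine (hJ.dom_iff s).trans ⟨hdom s, ?_⟩
    rintro ⟨j', hj'⟩
    obtain ⟨j, hj, -⟩ := hprev s j' hj'
    exact ⟨j, hj⟩
  · obtain ⟨j, hj, h, -⟩ := hprev s j' hj'
    rw [hJ.source_eq s j hj, h]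
  · exact (BoolFormula.eval_congr (fun θ => by simp only [hvalue]) _).2 hJ.guard
  · obtain ⟨j, hj, -, h⟩ := hprev _ j' hj'
    rw [← hρ, ← h]
    exact hJ.update_copy r s r' hf j hj
  · obtain ⟨j, -, hj⟩ := hJ.update_guess r k B hf
    refine ⟨i', ?_, ?_⟩
    · simp [Signature.ball]
    · rw [← hρ, hj, hd, hd']
  · rw [← hρ]
    exact hJ.update_undef r hf

/-- The two pictures are only connected through the diagonal. -/
theorem exists_eq_of_gridRel_of_lt_of_le {s : GridSymbol} {i j : ℕ} (h : gridRel n s i j)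
    (hi : i < n * n) (hj : n * n ≤ j) : ∃ k : Fin n, i = k * n + k := by
  have hn : 0 < n := Nat.pos_of_ne_zero (by rintro rfl; omega)
  rcases s with _ | _ | _
  · have h₁ : i / n < n := Nat.div_lt_of_lt_mul hi
    have h₂ : n ≤ j / n := (Nat.le_div_iff_mul_le hn).2 hj
    have := h.2
    omega
  · have := h.2.2
    omega
  · refine ⟨⟨i / n, Nat.div_lt_of_lt_mul hi⟩, ?_⟩
    have h₁ := Nat.div_add_mod' i n
    rw [← h.2.2.2] at h₁
    exact h₁.symm

theorem exists_pow_mul_lt (k c : ℕ) : ∃ n, k ^ n * c < 2 ^ (n * n) := by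
  refine ⟨k + c + 1, ?_⟩
  generalize hn : k + c + 1 = n
  calc k ^ n * c ≤ (2 ^ k) ^ n * c :=
        Nat.mul_le_mul_right _ (Nat.pow_le_pow_left Nat.lt_two_pow_self.le n)
    _ < (2 ^ k) ^ n * 2 ^ c := Nat.mul_lt_mul_of_pos_left Nat.lt_two_pow_self (by positivity)
    _ = 2 ^ (k * n + c) := by rw [← pow_mul, ← pow_add]
    _ ≤ 2 ^ (n * n) := Nat.pow_le_pow_right two_pos (by rw [← hn]; nlinarith)

/-- If an automaton accepts all pairs of equal pictures, then it accepts some pair of different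
pictures: an `n × n` picture has `n * n` bits, but only the configurations on its diagonal, of
which there are `k ^ n` for a constant `k`, and the numbers of states up to a fixed threshold matter
for the second half of a run. -/
theorem Automaton.exists_ne_pictureWord_mem (𝒜 : Automaton GridSymbol Bool m) (d : D)
    (h : ∀ (n : ℕ) (P : Fin (n * n) → Bool),
      pictureWord m d P P ∈ 𝒜.language (gridSignature D m)) :
    ∃ (n : ℕ) (P P' : Fin (n * n) → Bool), P ≠ P' ∧
      pictureWord m d P P' ∈ 𝒜.language (gridSignature D m) := by
  classical
  have := 𝒜.finite_Q
  have := 𝒜.finite_R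
  obtain ⟨T, hT⟩ := BoolFormula.exists_threshold 𝒜.Φ
  obtain ⟨n, hn⟩ := exists_pow_mul_lt (Nat.card (𝒜.Q × (𝒜.R → Bool)))
    (Nat.card (𝒜.Q → Fin (T + 1)))
  have hruns : ∀ P : Fin (n * n) → Bool, ∃ (q : Fin (2 * (n * n)) → 𝒜.Q)
      (ρ : Fin (2 * (n * n)) → 𝒜.R → Option D),
      𝒜.IsRun (gridSignature D m) (pictureWord m d P P) q ρ ∧
        𝒜.Accepting (gridSignature D m) (pictureWord m d P P) q := fun P => h n P
  choose q ρ hrun hacc using hruns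
  have hdiag : ∀ k : Fin n, (k : ℕ) * n + k < 2 * (n * n) := fun k => by
    have := mul_add_lt k.2 k.2
    omega
  let info : (Fin (n * n) → Bool) → (Fin n → 𝒜.Q × (𝒜.R → Bool)) × (𝒜.Q → Fin (T + 1)) :=
    fun P => (fun k => (q P ⟨_, hdiag k⟩, fun r => (ρ P ⟨_, hdiag k⟩ r).isSome),
      fun x => ⟨min ({i | q P i = x} ∩ {i | (i : ℕ) < n * n}).ncard T, by omega⟩)
  have hinfo : ¬ Function.Injective info := fun hinj => by
    have := Nat.card_le_card_of_injective info hinj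
    simp only [Nat.card_prod (Fin n → _), Nat.card_fun (α := Fin n), Nat.card_fun (α := Fin (n * n)),
      Nat.card_eq_fintype_card (α := Fin _), Nat.card_eq_fintype_card (α := Bool), Fintype.card_fin,
      Fintype.card_bool] at this
    omega
  obtain ⟨P, P', hPP', hne⟩ : ∃ P P', info P = info P' ∧ P ≠ P' := by
    simpa [Function.Injective] using hinfo
  have hρd : ∀ P i r x, ρ P i r = some x → x = d := fun P i =>
    (hrun P).register_eq (fun _ _ => rfl) i
  have hdiag_q : ∀ k : Fin n, q P ⟨_, hdiag k⟩ = q P' ⟨_, hdiag k⟩ := fun k =>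
    congrArg Prod.fst (congrFun (congrArg Prod.fst hPP') k)
  have hdiag_ρ : ∀ k : Fin n, ρ P ⟨_, hdiag k⟩ = ρ P' ⟨_, hdiag k⟩ := fun k => by
    funext r
    have := congrFun (congrArg Prod.snd (congrFun (congrArg Prod.fst hPP') k)) r
    simp only [info] at this
    rcases h₁ : ρ P ⟨_, hdiag k⟩ r with _ | x <;> rcases h₂ : ρ P' ⟨_, hdiag k⟩ r with _ | y
    · rfl
    · simp [h₁, h₂] at this
    · simp [h₁, h₂] at this
    · rw [hρd _ _ _ _ h₁, hρd _ _ _ _ h₂]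
  have hcount : ∀ x, min ({i | q P i = x} ∩ {i | (i : ℕ) < n * n}).ncard T =
      min ({i | q P' i = x} ∩ {i | (i : ℕ) < n * n}).ncard T := fun x =>
    congrArg Fin.val (congrFun (congrArg Prod.snd hPP') x)
  -- the run on the first picture of the pair `(P, P)` is continued by the one on the second
  -- picture of the pair `(P', P')`
  let q' : Fin (2 * (n * n)) → 𝒜.Q := fun i => if (i : ℕ) < n * n then q P i else q P' i
  let ρ' : Fin (2 * (n * n)) → 𝒜.R → Option D :=
    fun i => if (i : ℕ) < n * n then ρ P i else ρ P' i
  refine ⟨n, P, P', hne, q', ρ', fun i => ?_, fun i s hi => ?_, ?_⟩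
  · by_cases hin : (i : ℕ) < n * n
    · obtain ⟨t, ht, hJ⟩ := hrun P i
      refine ⟨t, ht, hJ.transfer (d := d) (fun _ _ => rfl) (fun _ _ => rfl) ?_ (if_pos hin).symm
        (if_pos hin).symm (fun s => ?_) fun s j hj => ⟨j, ?_, ?_⟩⟩
      · simp [DataWord.label, hin]
      · rintro ⟨j, hj⟩
        exact ⟨j, gridSignature_rel_pictureWord.2 (gridSignature_rel_pictureWord.1 hj)⟩
      · exact gridSignature_rel_pictureWord.2 (gridSignature_rel_pictureWord.1 hj)
      · have hji : (j : ℕ) < i := (gridSignature D m).lt_of_rel _ _ _ _ hj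
        have hjn : (j : ℕ) < n * n := hji.trans hin
        exact ⟨(if_pos hjn).symm, (if_pos hjn).symm⟩
    · obtain ⟨t, ht, hJ⟩ := hrun P' i
      refine ⟨t, ht, hJ.transfer (d := d) (fun _ _ => rfl) (fun _ _ => rfl) ?_ (if_neg hin).symm
        (if_neg hin).symm (fun s => ?_) fun s j hj => ⟨j, ?_, ?_⟩⟩
      · simp [DataWord.label, hin]
      · rintro ⟨j, hj⟩
        exact ⟨j, gridSignature_rel_pictureWord.2 (gridSignature_rel_pictureWord.1 hj)⟩
      · exact gridSignature_rel_pictureWord.2 (gridSignature_rel_pictureWord.1 hj)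
      · by_cases hjn : (j : ℕ) < n * n
        · obtain ⟨k, hk⟩ := exists_eq_of_gridRel_of_lt_of_le
            (gridSignature_rel_pictureWord.1 hj) hjn (not_lt.1 hin)
          obtain rfl : j = ⟨_, hdiag k⟩ := Fin.ext hk
          exact ⟨(hdiag_q k).symm.trans (if_pos hjn).symm,
            (hdiag_ρ k).symm.trans (if_pos hjn).symm⟩
        · exact ⟨(if_neg hjn).symm, (if_neg hjn).symm⟩
  · have hi' : ∀ P₀, ¬ ∃ j, (gridSignature D m).Rel s (pictureWord m d P₀ P₀) i j := by
      rintro P₀ ⟨j, hj⟩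
      exact hi ⟨j, gridSignature_rel_pictureWord.2 (gridSignature_rel_pictureWord.1 hj)⟩
    by_cases hin : (i : ℕ) < n * n
    · rw [show q' i = q P i from if_pos hin]
      exact (hacc P).1 i s (hi' P)
    · rw [show q' i = q P' i from if_neg hin]
      exact (hacc P').1 i s (hi' P')
  · refine (hT (fun x => {i | q' i = x}.ncard) (fun x => {i | q P' i = x}.ncard) fun x => ?_).2
      (hacc P').2
    have e₁ : {i | q' i = x} ∩ {i | (i : ℕ) < n * n} =
        {i | q P i = x} ∩ {i | (i : ℕ) < n * n} := by
      ext i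
      refine and_congr_left fun hin => ?_
      rw [Set.mem_ofPred_eq, show q' i = q P i from if_pos hin, Set.mem_ofPred_eq]
    have e₂ : {i | q' i = x} \ {i | (i : ℕ) < n * n} =
        {i | q P' i = x} \ {i | (i : ℕ) < n * n} := by
      ext i
      refine and_congr_left fun hin => ?_
      rw [Set.mem_ofPred_eq, show q' i = q P' i from if_neg hin, Set.mem_ofPred_eq]
    have h₁ := Set.ncard_inter_add_ncard_sdiff_eq_ncard {i | q' i = x} {i | (i : ℕ) < n * n}
    have h₂ := Set.ncard_inter_add_ncard_sdiff_eq_ncard {i | q P' i = x} {i | (i : ℕ) < n * n}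
    have h₃ := hcount x
    rw [e₁, e₂] at h₁
    omega

theorem Model.admits_markAutomaton (C : Model) : C.Admits (markAutomaton m) := by
  cases C with
  | cra => trivial
  | craMinus => exact fun _ _ r => r.elim
  | cma => exact fun _ _ r => r.elim

theorem Model.compl_notMem_lang [Nonempty D] (C : Model) :
    ((markAutomaton m).language (gridSignature D m))ᶜ ∉ C.Lang (gridSignature D m) := by
  rintro ⟨𝒜, -, h𝒜⟩
  obtain ⟨n, P, P', hne, hmem⟩ := 𝒜.exists_ne_pictureWord_mem (Classical.arbitrary D) fun n P => by
    rw [h𝒜]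
    exact pictureWord_self_notMem
  rw [h𝒜] at hmem
  exact hmem (pictureWord_mem_of_ne hne)

end Mixing

end ClassRegister

theorem lemma2 (D : Type*) [Infinite D] :
    (∀ (C : ClassRegister.Model) (m : ℕ) (A : Type*) [Finite A] [Nonempty A]
        (σ : Type*) [Finite σ] (S : ClassRegister.Signature σ A D m),
      (∀ L₁ ∈ C.Lang S, ∀ L₂ ∈ C.Lang S, L₁ ∪ L₂ ∈ C.Lang S) ∧
      (∀ L₁ ∈ C.Lang S, ∀ L₂ ∈ C.Lang S, L₁ ∩ L₂ ∈ C.Lang S) ∧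
      (∀ (Γ : Type*) [Finite Γ] [Nonempty Γ], ∀ L ∈ C.Lang (S.extend Γ),
        ClassRegister.DataWord.proj '' L ∈ C.Lang S)) ∧
    (∃ (m : ℕ) (A : Type) (σ : Type) (_ : Finite A) (_ : Nonempty A) (_ : Finite σ)
        (S : ClassRegister.Signature σ A D m),
      ∀ C : ClassRegister.Model, ∃ L ∈ C.Lang S, Lᶜ ∉ C.Lang S) := by
  refine ⟨fun C m A _ _ σ _ S => ⟨fun L₁ h₁ L₂ h₂ => ClassRegister.Model.union_mem_lang h₁ h₂,
    fun L₁ h₁ L₂ h₂ => ClassRegister.Model.inter_mem_lang h₁ h₂,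
    fun Γ _ _ L h => ClassRegister.Model.proj_image_mem_lang h⟩, ?_⟩
  exact ⟨1, Bool, ClassRegister.GridSymbol, inferInstance, inferInstance,
    ClassRegister.GridSymbol.finite, ClassRegister.gridSignature D 1, fun C =>
      ⟨_, ⟨_, C.admits_markAutomaton, rfl⟩, C.compl_notMem_lang⟩⟩
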